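/- Let $\mathcal H$ be a complex Hilbert space and let $B$, $C$ be linear operators in $\mathcal H$ with domains $\mathcal D(B)$, $\mathcal D(C)$. Sums and products of operators carry their natural domains; in particular $\mathcal D(B^2)=\{x\in\mathcal D(B): Bx\in\mathcal D(B)\}$. A linear operator $T$ is called accretive if $\operatorname{Re}\langle Tx,x\rangle\ge 0$ for all $x\in\mathcal D(T)$, and m-accretive if moreover it is densely defined and $\mu+T$ maps $\mathcal D(T)$ onto $\mathcal H$ for every $\mu>0$. Assume that $B^2$ is m-accretive, that $C$ is accretive, that $\mathcal D(B^2)\subset\mathcal D(C)$, and that there are $\alpha\ge 0$, $0\le\beta<1$, $\delta\ge 0$ with $$\operatorname{Re}\langle B^2x,Cx\rangle\ \ge\ -\alpha\|x\|^2-\beta\|B^2x\|^2-\delta\|B^2x\|\,\|x\|\qquad\text{for all }x\in\mathcal D(B^2).$$ Let $\Lambda=B^2+C$ with domain $\mathcal D(B^2)$ (an m-accretive operator), and let $\Lambda^{1/2}$ be its square root, that is, the closure of the operator $$x\longmapsto \frac1\pi\int_0^\infty t^{-1/2}\,\Lambda(t+\Lambda)^{-1}x\,dt,\qquad x\in\mathcal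 D(\Lambda).$$ For $\lambda\in\mathbb C$ put $Q(\lambda)=\lambda^2 I-2\lambda B-C$ with domain $\mathcal D(B)\cap\mathcal D(C)$, and let $Z_1=B+\Lambda^{1/2}$, $Z_2=B-\Lambda^{1/2}$ with domain $\mathcal D(B)\cap\mathcal D(\Lambda^{1/2})$. Suppose that $B(\mathcal D(B^2))\subset\mathcal D(B^2)$ and $\Lambda^{1/2}(\mathcal D(B^2))\subset\mathcal D(B^2)$. Then for every $\lambda\in\mathbb C$ and every $x\in\mathcal D(B^2)$, the vector $x$ belongs to the domains of $Q(\lambda)$, $(\lambda I-Z_1)(\lambda I-Z_2)$ and $(\lambda I-Z_2)(\lambda I-Z_1)$, and $$Q(\lambda)x=\tfrac12(\lambda I-Z_1)(\lambda I-Z_2)x+\tfrac12(\lambda I-Z_2)(\lambda I-Z_1)x.$$ If in addition $B\Lambda^{1/2}x=\Lambda^{1/2}Bx$ for all $x\in\mathcal D(B^2)$, then for every $\lambda\in\mathbb C$ and every $x\in\mathcal D(B^2)$ $$Q(\lambda)x=(\lambda I-Z_1)(\lambda I-Z_2)x=(\lambda I-Z_2)(\lambda I-Z_1)x.$$ -/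

import Mathlib

noncomputable section

namespace QuadPencil

variable {H : Type*} [NormedAddCommGroup H] [InnerProductSpace ℂ H]

/-- The operator `c I`, defined on the whole space. -/
def scalar (c : ℂ) : H →ₗ.[ℂ] H := (c • LinearMap.id : H →ₗ[ℂ] H).toPMap ⊤

/-- The product `f g` of two unbounded operators, with its natural domain
`{x ∈ D(g) | g x ∈ D(f)}`. -/
def prod (f g : H →ₗ.[ℂ] H) : H →ₗ.[ℂ] H where
  domain := (f.domain.comap g.toFun).map g.domain.subtype
  toFun :=
    { toFun := fun x => f ⟨g ⟨x.1, by
          obtain ⟨y, -, hy⟩ := x.2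
          exact hy ▸ y.2⟩, by
          obtain ⟨x, y, hy, rfl⟩ := x
          exact hy⟩
      map_add' := fun x y => by
        rw [← f.map_add]
        congr 1
        exact Subtype.ext (g.map_add ⟨x.1, _⟩ ⟨y.1, _⟩)
      map_smul' := fun c x => by
        rw [RingHom.id_apply, ← f.map_smul]
        congr 1
        exact Subtype.ext (g.map_smul c ⟨x.1, _⟩) }

theorem mem_prod_domain {f g : H →ₗ.[ℂ] H} {x : H} :
    x ∈ (prod f g).domain ↔ ∃ h : x ∈ g.domain, g ⟨x, h⟩ ∈ f.domain := by
  constructor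
  · rintro ⟨y, hy, rfl⟩
    exact ⟨y.2, hy⟩
  · rintro ⟨h, h'⟩
    exact ⟨⟨x, h⟩, h', rfl⟩

theorem prod_apply {f g : H →ₗ.[ℂ] H} {x : H} (h : x ∈ g.domain) (h' : g ⟨x, h⟩ ∈ f.domain)
    (hx : x ∈ (prod f g).domain) : prod f g ⟨x, hx⟩ = f ⟨g ⟨x, h⟩, h'⟩ := rfl

/-- `T` is accretive: `Re ⟨T x, x⟩ ≥ 0` on the domain of `T`. -/
def IsAccretive (T : H →ₗ.[ℂ] H) : Prop :=
  ∀ x : T.domain, 0 ≤ (inner ℂ (T x) (x : H)).re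

/-- `T` is m-accretive: accretive, densely defined, and `μ + T` is onto for all `μ > 0`. -/
def IsMAccretive (T : H →ₗ.[ℂ] H) : Prop :=
  IsAccretive T ∧ Dense (T.domain : Set H) ∧
    ∀ μ : ℝ, 0 < μ → ∀ y : H, ∃ x : T.domain, (μ : ℂ) • (x : H) + T x = y

/-- The graph of the Balakrishnan operator
`x ↦ (1 / π) ∫₀^∞ t ^ (-1/2) T (t + T)⁻¹ x dt`, `x ∈ D(T)`.
Here `r t = (t + T)⁻¹ x`, which is unique (and exists) for every `t > 0` if `T` is m-accretive. -/
def balakrishnanGraph (T : H →ₗ.[ℂ] H) : Submodule ℂ (H × H) where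
  carrier := {p | p.1 ∈ T.domain ∧ ∃ r : ℝ → T.domain,
    (∀ t : ℝ, 0 < t → (t : ℂ) • (r t : H) + T (r t) = p.1) ∧
    MeasureTheory.IntegrableOn (fun t : ℝ => ((t ^ (-(1 / 2) : ℝ) : ℝ) : ℂ) • T (r t))
      (Set.Ioi 0) ∧
    p.2 = ((1 / Real.pi : ℝ) : ℂ) •
      ∫ t in Set.Ioi (0 : ℝ), ((t ^ (-(1 / 2) : ℝ) : ℝ) : ℂ) • T (r t)}
  add_mem' := by
    rintro ⟨x, y⟩ ⟨x', y'⟩ ⟨hx, r, hr, hi, hy⟩ ⟨hx', r', hr', hi', hy'⟩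
    refine ⟨T.domain.add_mem hx hx', fun t => r t + r' t, fun t ht => ?_, ?_, ?_⟩
    · have h1 := hr t ht
      have h2 := hr' t ht
      simp only at h1 h2
      simp only [T.map_add, Submodule.coe_add, Prod.mk_add_mk, ← h1, ← h2, smul_add]
      abel
    · simp only [T.map_add, smul_add]
      exact hi.add hi'
    · simp only at hy hy'
      simp only [T.map_add, smul_add, Prod.mk_add_mk]
      rw [MeasureTheory.integral_add hi hi', smul_add, hy, hy']
  zero_mem' := by
    refine ⟨T.domain.zero_mem, fun _ => 0, fun t _ => ?_, ?_, ?_⟩ <;> simp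
  smul_mem' := by
    rintro c ⟨x, y⟩ ⟨hx, r, hr, hi, hy⟩
    have key : ∀ t : ℝ, ((t ^ (-(1 / 2) : ℝ) : ℝ) : ℂ) • T (c • r t) =
        c • (((t ^ (-(1 / 2) : ℝ) : ℝ) : ℂ) • T (r t)) := fun t => by
      rw [T.map_smul, smul_comm]
    refine ⟨T.domain.smul_mem c hx, fun t => c • r t, fun t ht => ?_, ?_, ?_⟩
    · have h1 := hr t ht
      simp only at h1
      simp only [T.map_smul, Submodule.coe_smul, Prod.smul_mk, ← h1, smul_add]
      rw [smul_comm]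
    · simp only [key]
      exact MeasureTheory.Integrable.smul c hi
    · simp only at hy
      simp only [key, Prod.smul_mk]
      rw [MeasureTheory.integral_smul, smul_comm, hy]

/-- The square root `T ^ (1/2)` of an m-accretive operator `T`: the closure of the Balakrishnan
operator, so that `D(T)` is a core of `T ^ (1/2)`. -/
def sqrt (T : H →ₗ.[ℂ] H) : H →ₗ.[ℂ] H := (balakrishnanGraph T).toLinearPMap.closure

/-- `B²`, with domain `{x ∈ D(B) | B x ∈ D(B)}`. -/
def square (B : H →ₗ.[ℂ] H) : H →ₗ.[ℂ] H := prod B B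

/-- The pencil `Q(c) = c² I - 2 c B - C` with domain `D(B) ∩ D(C)`. -/
def pencil (B C : H →ₗ.[ℂ] H) (c : ℂ) : H →ₗ.[ℂ] H :=
  scalar (c ^ 2) - (2 * c) • B - C

/-- `Λ = B² + C`, with domain `D(B²) ∩ D(C)`, which is `D(B²)` if `D(B²) ⊆ D(C)`. -/
def Lam (B C : H →ₗ.[ℂ] H) : H →ₗ.[ℂ] H := square B + C

/-- `Z₁ = B + Λ ^ (1/2)` with domain `D(B) ∩ D(Λ ^ (1/2))`. -/
def Z₁ (B C : H →ₗ.[ℂ] H) : H →ₗ.[ℂ] H := B + sqrt (Lam B C)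

/-- `Z₂ = B - Λ ^ (1/2)` with domain `D(B) ∩ D(Λ ^ (1/2))`. -/
def Z₂ (B C : H →ₗ.[ℂ] H) : H →ₗ.[ℂ] H := B - sqrt (Lam B C)

/-- The product `(c I - Z)(c I - W)` with its natural domain. -/
def factors (Z W : H →ₗ.[ℂ] H) (c : ℂ) : H →ₗ.[ℂ] H := prod (scalar c - Z) (scalar c - W)

end QuadPencil

end

open MeasureTheory Set Filter Topology

namespace QuadPencil

/-! Write S for Λ^(1/2). On D(B²) the products (λ - Z₁)(λ - Z₂) and (λ - Z₂)(λ - Z₁) multiply out to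
λ² - 2λB + B² - S² ∓ (BS - SB), the two invariance hypotheses keeping every term defined. Averaging,
or commutation, removes the commutator; as B² - Λ = -C there, what remains to show is S²x = Λx.

Two facts give this. First, t + Λ is onto for t > 0 (`IsMAccretive.exists_smul_add_eq`): along B² +
κC, 0 ≤ κ ≤ 1, the bound on Re⟨B²x, Cx⟩ yields an a priori estimate uniform in κ, so solvability
spreads from κ = 0 to κ = 1.

Second, the Balakrishnan integral J satisfies JJx = π²Tx
(`IsResolventFamily.balakrishnan_balakrishnan`). With Y_t = T(t + T)⁻¹, JJx is the integral of
s^(-1/2) t^(-1/2) Y_s Y_t x. Subtracting (1 + s)⁻¹(1 + t)⁻¹ Tx, whose weighted integral is π²Tx,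
leaves a kernel whose integral along each ray t = su, u ≠ 1, vanishes by the resolvent identity and
scaling. In the coordinates (s, u) the weight depends on u alone, so Fubini concludes. The decay
this needs holds on D(T²); the resolvent at 1, injective and commuting with J, removes the
restriction. -/

/-! ### Scalar kernels and integration along rays -/

theorem integrableOn_rpow_neg_half_mul_inv_one_add :
    IntegrableOn (fun t : ℝ => t ^ (-(1 / 2) : ℝ) * (1 + t)⁻¹) (Ioi 0) := by
  have h := (integrableOn_Ioi_comp_rpow_iff' (fun y : ℝ => (1 + y ^ 2)⁻¹)
    (p := 1 / 2) (by norm_num)).2 integrable_inv_one_add_sq.integrableOn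
  refine h.congr_fun (fun t (ht : 0 < t) => ?_) measurableSet_Ioi
  simp only [smul_eq_mul]
  rw [← Real.rpow_natCast (t ^ (1 / 2 : ℝ)) 2, ← Real.rpow_mul ht.le]
  norm_num

theorem integral_rpow_neg_half_mul_inv_one_add :
    ∫ t in Ioi (0 : ℝ), t ^ (-(1 / 2) : ℝ) * (1 + t)⁻¹ = Real.pi := by
  have h := integral_comp_rpow_Ioi_of_pos (g := fun y : ℝ => 2 * (1 + y ^ 2)⁻¹)
    (p := 1 / 2) (by norm_num)
  rw [integral_const_mul, integral_Ioi_inv_one_add_sq, Real.arctan_zero, sub_zero,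
    mul_div_cancel₀ _ two_ne_zero] at h
  rw [← h]
  refine setIntegral_congr_fun measurableSet_Ioi (fun t (ht : 0 < t) => ?_)
  simp only [smul_eq_mul]
  rw [← Real.rpow_natCast (t ^ (1 / 2 : ℝ)) 2, ← Real.rpow_mul ht.le]
  norm_num
  ring

theorem rpow_neg_half_mul_self_mul {s : ℝ} (hs : 0 < s) :
    s ^ (-(1 / 2) : ℝ) * (s * s ^ (-(1 / 2) : ℝ)) = 1 := by
  nth_rw 2 [← Real.rpow_one s]
  rw [← Real.rpow_add hs, ← Real.rpow_add hs]
  norm_num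

theorem rpow_neg_half_mul_inv_one_add_comp {s u : ℝ} (hs : 0 < s) (hu : 0 < u) :
    u ^ (-(1 / 2) : ℝ) * (1 + s * u)⁻¹ =
      s * s ^ (-(1 / 2) : ℝ) * ((s * u) ^ (-(1 / 2) : ℝ) * (1 + s * u)⁻¹) := by
  rw [Real.mul_rpow hs.le hu.le]
  linear_combination (-(u ^ (-(1 / 2) : ℝ) * (1 + s * u)⁻¹)) * rpow_neg_half_mul_self_mul hs

/-- By scaling, the integral over u of u^(-1/2) (1 + su)⁻¹ is π s^(-1/2), which Tonelli reduces to
the one-variable kernel. This is the dominating function after the substitution t = su. -/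
theorem integrable_dilated_kernel :
    Integrable (fun p : ℝ × ℝ => (1 + p.1)⁻¹ * (p.2 ^ (-(1 / 2) : ℝ) * (1 + p.1 * p.2)⁻¹))
      ((volume.restrict (Ioi 0)).prod (volume.restrict (Ioi 0))) := by
  have hm : Measurable (fun p : ℝ × ℝ =>
      (1 + p.1)⁻¹ * (p.2 ^ (-(1 / 2) : ℝ) * (1 + p.1 * p.2)⁻¹)) := by fun_prop
  refine (integrable_prod_iff hm.aestronglyMeasurable).2 ⟨?_, ?_⟩
  · filter_upwards [self_mem_ae_restrict measurableSet_Ioi] with s (hs : 0 < s)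
    have h : IntegrableOn (fun u : ℝ => s * s ^ (-(1 / 2) : ℝ) *
        ((s * u) ^ (-(1 / 2) : ℝ) * (1 + s * u)⁻¹)) (Ioi 0) :=
      Integrable.const_mul ((integrableOn_Ioi_comp_mul_left_iff
        (fun t : ℝ => t ^ (-(1 / 2) : ℝ) * (1 + t)⁻¹) 0 hs).2
          (by rw [mul_zero]; exact integrableOn_rpow_neg_half_mul_inv_one_add)) _
    exact Integrable.const_mul (h.congr_fun
      (fun u (hu : 0 < u) => (rpow_neg_half_mul_inv_one_add_comp hs hu).symm)
        measurableSet_Ioi) _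
  · refine IntegrableOn.congr_fun
      (integrableOn_rpow_neg_half_mul_inv_one_add.mul_const Real.pi)
      (fun s (hs : 0 < s) => ?_) measurableSet_Ioi
    have h : ∫ u in Ioi (0 : ℝ), u ^ (-(1 / 2) : ℝ) * (1 + s * u)⁻¹ =
        s ^ (-(1 / 2) : ℝ) * Real.pi := by
      rw [setIntegral_congr_fun measurableSet_Ioi
        (fun u (hu : 0 < u) => rpow_neg_half_mul_inv_one_add_comp hs hu), integral_const_mul,
        integral_comp_mul_left_Ioi (fun t : ℝ => t ^ (-(1 / 2) : ℝ) * (1 + t)⁻¹) 0 hs, mul_zero,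
        integral_rpow_neg_half_mul_inv_one_add, smul_eq_mul]
      field_simp
    calc s ^ (-(1 / 2) : ℝ) * (1 + s)⁻¹ * Real.pi
        = (1 + s)⁻¹ * ∫ u in Ioi (0 : ℝ), u ^ (-(1 / 2) : ℝ) * (1 + s * u)⁻¹ := by
          rw [h]; ring
      _ = ∫ u in Ioi (0 : ℝ), (1 + s)⁻¹ * (u ^ (-(1 / 2) : ℝ) * (1 + s * u)⁻¹) := by
          rw [integral_const_mul]
      _ = _ := by
          refine setIntegral_congr_fun measurableSet_Ioi (fun u (hu : 0 < u) => ?_)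
          exact (Real.norm_of_nonneg (by positivity)).symm

/-- A kernel on the quadrant whose integrals along the rays `t = s u` vanish is orthogonal to
`s ^ (-1/2) t ^ (-1/2)`. -/
theorem integral_integral_eq_zero_of_ray {E : Type*} [NormedAddCommGroup E] [NormedSpace ℝ E]
    {F : ℝ → ℝ → E} {M : ℝ}
    (hF : ContinuousOn (fun p : ℝ × ℝ => F p.1 p.2) (Ioi 0 ×ˢ Ioi 0))
    (hM : ∀ s t : ℝ, 0 < s → 0 < t → ‖F s t‖ ≤ M * ((1 + s)⁻¹ * (1 + t)⁻¹))
    (h0 : ∀ u : ℝ, 0 < u → u ≠ 1 → ∫ s in Ioi (0 : ℝ), F s (s * u) = 0) :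
    ∫ s in Ioi (0 : ℝ), s ^ (-(1 / 2) : ℝ) •
      ∫ t in Ioi (0 : ℝ), t ^ (-(1 / 2) : ℝ) • F s t = 0 := by
  have hint : Integrable (Function.uncurry fun s u : ℝ => u ^ (-(1 / 2) : ℝ) • F s (s * u))
      ((volume.restrict (Ioi 0)).prod (volume.restrict (Ioi 0))) := by
    have hmeas : AEStronglyMeasurable
        (Function.uncurry fun s u : ℝ => u ^ (-(1 / 2) : ℝ) • F s (s * u))
        ((volume.restrict (Ioi 0)).prod (volume.restrict (Ioi 0))) := by
      rw [Measure.prod_restrict]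
      refine ContinuousOn.aestronglyMeasurable ?_ (measurableSet_Ioi.prod measurableSet_Ioi)
      have h1 : ContinuousOn (fun p : ℝ × ℝ => p.2 ^ (-(1 / 2) : ℝ)) (Ioi 0 ×ˢ Ioi 0) :=
        continuousOn_snd.rpow_const fun p hp => Or.inl (ne_of_gt hp.2)
      have h2 : ContinuousOn (fun p : ℝ × ℝ => F p.1 (p.1 * p.2)) (Ioi 0 ×ˢ Ioi 0) :=
        hF.comp (f := fun p : ℝ × ℝ => (p.1, p.1 * p.2)) (by fun_prop)
          fun p hp => ⟨hp.1, mul_pos (mem_Ioi.1 hp.1) (mem_Ioi.1 hp.2)⟩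
      exact h1.smul h2
    refine (integrable_dilated_kernel.const_mul M).mono' hmeas ?_
    rw [Measure.prod_restrict]
    filter_upwards [self_mem_ae_restrict (measurableSet_Ioi.prod measurableSet_Ioi)] with p hp
    obtain ⟨hs, hu⟩ : 0 < p.1 ∧ 0 < p.2 := hp
    have hw : 0 ≤ p.2 ^ (-(1 / 2) : ℝ) := by positivity
    rw [Function.uncurry, norm_smul, Real.norm_of_nonneg hw]
    calc _ ≤ p.2 ^ (-(1 / 2) : ℝ) * (M * ((1 + p.1)⁻¹ * (1 + p.1 * p.2)⁻¹)) := by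
          gcongr
          exact hM _ _ hs (mul_pos hs hu)
      _ = _ := by ring
  calc _ = ∫ s in Ioi (0 : ℝ), ∫ u in Ioi (0 : ℝ), u ^ (-(1 / 2) : ℝ) • F s (s * u) := by
        refine setIntegral_congr_fun measurableSet_Ioi (fun s (hs : 0 < s) => ?_)
        -- Substitute t = su: the outer weight, the Jacobian s and the factor s^(-1/2) of t^(-1/2)
        -- multiply to 1.
        have h := integral_comp_mul_left_Ioi' (fun t : ℝ => t ^ (-(1 / 2) : ℝ) • F s t) 0 hs
        rw [mul_zero] at h
        rw [← h]
        have h' : ∫ u in Ioi (0 : ℝ), (s * u) ^ (-(1 / 2) : ℝ) • F s (s * u) =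
            s ^ (-(1 / 2) : ℝ) • ∫ u in Ioi (0 : ℝ), u ^ (-(1 / 2) : ℝ) • F s (s * u) := by
          rw [← integral_smul]
          refine setIntegral_congr_fun measurableSet_Ioi (fun u (hu : 0 < u) => ?_)
          simp only [Real.mul_rpow hs.le hu.le, mul_smul]
        rw [h', smul_smul, smul_smul, mul_assoc, rpow_neg_half_mul_self_mul hs, one_smul]
    _ = ∫ u in Ioi (0 : ℝ), ∫ s in Ioi (0 : ℝ), u ^ (-(1 / 2) : ℝ) • F s (s * u) :=
        integral_integral_swap hint
    _ = ∫ u in Ioi (0 : ℝ), 0 := by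
        refine integral_congr_ae ?_
        filter_upwards [self_mem_ae_restrict measurableSet_Ioi,
          ae_restrict_of_ae (Measure.ae_ne volume (1 : ℝ))] with u hu hu1
        rw [integral_smul, h0 u hu hu1, smul_zero]
    _ = 0 := by simp

/-! ### Resolvent families and the square of the Balakrishnan integral -/

section ResolventFamily

variable {E : Type*} [NormedAddCommGroup E] [NormedSpace ℝ E]

/-- `R t`, `t > 0`, behaves as the resolvent `(t + T)⁻¹` of an m-accretive operator `T`. -/
structure IsResolventFamily (R : ℝ → E →L[ℝ] E) : Prop where
  sub_eq : ∀ s t : ℝ, 0 < s → 0 < t → ∀ y, R s y - R t y = (t - s) • R s (R t y)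
  norm_le : ∀ t : ℝ, 0 < t → ∀ y, t * ‖R t y‖ ≤ ‖y‖

/-- The Yosida approximation `T (t + T)⁻¹ = 1 - t (t + T)⁻¹`. -/
def yosida (R : ℝ → E →L[ℝ] E) (t : ℝ) : E →L[ℝ] E := ContinuousLinearMap.id ℝ E - t • R t

theorem yosida_apply (R : ℝ → E →L[ℝ] E) (t : ℝ) (x : E) : yosida R t x = x - t • R t x := rfl

/-- `T x = z` for the operator `T` whose resolvents are `R t`. -/
def IsGenPair (R : ℝ → E →L[ℝ] E) (x z : E) : Prop := ∀ t : ℝ, 0 < t → yosida R t x = R t z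

/-- The Balakrishnan integral of `x`, without the factor `1 / π`. -/
noncomputable def balakrishnan (R : ℝ → E →L[ℝ] E) (x : E) : E :=
  ∫ t in Ioi (0 : ℝ), t ^ (-(1 / 2) : ℝ) • yosida R t x

/-- Multiplied by 1 + s, the left side is R s z - Y_s z = Y_s x - Y_s z. The subtraction cancels the
1/s tail of R s z. -/
theorem IsGenPair.apply_sub_inv_smul {R : ℝ → E →L[ℝ] E} {x z : E} (h : IsGenPair R x z)
    {s : ℝ} (hs : 0 < s) : R s z - (1 + s)⁻¹ • z = (1 + s)⁻¹ • yosida R s (x - z) := by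
  have h1 : (1 + s) ≠ 0 := by positivity
  refine smul_right_injective E h1 ?_
  simp only [smul_sub, smul_smul, mul_inv_cancel₀ h1, one_smul, map_sub, h s hs]
  rw [yosida_apply]
  module

namespace IsResolventFamily

variable {R : ℝ → E →L[ℝ] E} (hR : IsResolventFamily R)
include hR

theorem comm {s t : ℝ} (hs : 0 < s) (ht : 0 < t) (y : E) : R s (R t y) = R t (R s y) := by
  rcases eq_or_ne s t with rfl | h
  · rfl
  · have h1 := hR.sub_eq s t hs ht y
    have h2 := hR.sub_eq t s ht hs y
    have h3 : (t - s) • R s (R t y) = (t - s) • R t (R s y) := by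
      rw [← h1, ← neg_sub s t, neg_smul, ← h2, neg_sub]
    exact smul_right_injective E (sub_ne_zero.2 h.symm) h3

theorem yosida_comm {s t : ℝ} (hs : 0 < s) (ht : 0 < t) (y : E) :
    R s (yosida R t y) = yosida R t (R s y) := by
  simp only [yosida_apply, map_sub, map_smul, hR.comm hs ht]

theorem opNorm_le {t : ℝ} (ht : 0 < t) : ‖R t‖ ≤ t⁻¹ := by
  refine ContinuousLinearMap.opNorm_le_bound _ (by positivity) fun y => ?_
  rw [inv_mul_eq_div, le_div_iff₀ ht, mul_comm]
  exact hR.norm_le t ht y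

theorem continuousOn : ContinuousOn R (Ioi 0) := by
  intro s (hs : 0 < s)
  refine ContinuousAt.continuousWithinAt (tendsto_iff_norm_sub_tendsto_zero.2 ?_)
  have hb : Tendsto (fun t : ℝ => |s - t| * (t⁻¹ * s⁻¹)) (𝓝 s) (𝓝 0) := by
    have h : ContinuousAt (fun t : ℝ => |s - t| * (t⁻¹ * s⁻¹)) s := by
      have := continuousAt_inv₀ hs.ne'
      fun_prop
    simpa [ContinuousAt] using h
  refine tendsto_of_tendsto_of_tendsto_of_le_of_le' tendsto_const_nhds hb
    (Eventually.of_forall fun _ => norm_nonneg _) ?_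
  filter_upwards [eventually_gt_nhds hs] with t ht
  have h : R t - R s = (s - t) • (R t ∘L R s) := by
    ext y
    exact hR.sub_eq t s ht hs y
  rw [h, norm_smul, Real.norm_eq_abs]
  gcongr
  exact (ContinuousLinearMap.opNorm_comp_le _ _).trans
    (mul_le_mul (hR.opNorm_le ht) (hR.opNorm_le hs) (norm_nonneg _) (by positivity))

theorem continuousOn_yosida : ContinuousOn (yosida R) (Ioi 0) :=
  continuousOn_const.sub (continuousOn_id.smul hR.continuousOn)

theorem norm_yosida_le {t : ℝ} (ht : 0 < t) (y : E) : ‖yosida R t y‖ ≤ 2 * ‖y‖ := by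
  have h := hR.norm_le t ht y
  calc ‖yosida R t y‖ ≤ ‖y‖ + ‖t • R t y‖ := norm_sub_le _ _
    _ = ‖y‖ + t * ‖R t y‖ := by rw [norm_smul, Real.norm_of_nonneg ht.le]
    _ ≤ 2 * ‖y‖ := by linarith

/-- The bounds 2‖x‖ for Y_t x and ‖z‖ for t Y_t x = t R_t z add up. -/
theorem norm_yosida_le_of_isGenPair {x z : E} (h : IsGenPair R x z) {t : ℝ} (ht : 0 < t) :
    ‖yosida R t x‖ ≤ (2 * ‖x‖ + ‖z‖) * (1 + t)⁻¹ := by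
  have h1 := hR.norm_le t ht z
  rw [← h t ht] at h1
  have h2 := hR.norm_yosida_le ht x
  rw [← div_eq_mul_inv, le_div_iff₀ (by positivity)]
  linarith

theorem isGenPair_yosida {x z : E} (h : IsGenPair R x z) {t : ℝ} (ht : 0 < t) :
    IsGenPair R (yosida R t x) (yosida R t z) := fun s hs => by
  rw [hR.yosida_comm hs ht, ← h s hs]
  simp only [yosida_apply, map_sub, map_smul, hR.comm hs ht]
  module

theorem isGenPair_apply {x z : E} (h : IsGenPair R x z) {t : ℝ} (ht : 0 < t) :
    IsGenPair R (R t x) (R t z) := fun s hs => by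
  rw [← hR.yosida_comm ht hs, h s hs, hR.comm ht hs]

/-- Together with `isGenPair_apply`, this puts R t x in D(T²) whenever x is in D(T). -/
theorem isGenPair_apply_yosida {t : ℝ} (ht : 0 < t) (z : E) :
    IsGenPair R (R t z) (yosida R t z) := fun s hs => by
  have h := hR.sub_eq s t hs ht z
  simp only [yosida_apply, map_sub, map_smul]
  rw [sub_eq_iff_eq_add] at h
  rw [h]
  module

theorem norm_yosida_yosida_le {x z z' : E} (h : IsGenPair R x z) (h' : IsGenPair R z z')
    {s t : ℝ} (hs : 0 < s) (ht : 0 < t) :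
    ‖yosida R s (yosida R t x)‖ ≤
      (2 * (2 * ‖x‖ + ‖z‖) + (2 * ‖z‖ + ‖z'‖)) * ((1 + s)⁻¹ * (1 + t)⁻¹) := by
  refine (hR.norm_yosida_le_of_isGenPair (hR.isGenPair_yosida h ht) hs).trans ?_
  have h1 := hR.norm_yosida_le_of_isGenPair h ht
  have h2 := hR.norm_yosida_le_of_isGenPair h' ht
  calc _ ≤ (2 * ((2 * ‖x‖ + ‖z‖) * (1 + t)⁻¹) + (2 * ‖z‖ + ‖z'‖) * (1 + t)⁻¹) * (1 + s)⁻¹ := by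
        gcongr
    _ = _ := by ring

theorem integrableOn_balakrishnan {x z : E} (h : IsGenPair R x z) :
    IntegrableOn (fun t : ℝ => t ^ (-(1 / 2) : ℝ) • yosida R t x) (Ioi 0) := by
  refine (integrableOn_rpow_neg_half_mul_inv_one_add.const_mul (2 * ‖x‖ + ‖z‖)).mono' ?_ ?_
  · refine ContinuousOn.aestronglyMeasurable ?_ measurableSet_Ioi
    exact (continuousOn_id.rpow_const fun t ht => Or.inl (ne_of_gt ht)).smul
      (hR.continuousOn_yosida.clm_apply continuousOn_const)
  · filter_upwards [self_mem_ae_restrict measurableSet_Ioi] with t (ht : 0 < t)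
    rw [norm_smul, Real.norm_of_nonneg (by positivity : (0 : ℝ) ≤ t ^ (-(1 / 2) : ℝ))]
    calc _ ≤ t ^ (-(1 / 2) : ℝ) * ((2 * ‖x‖ + ‖z‖) * (1 + t)⁻¹) := by
          gcongr
          exact hR.norm_yosida_le_of_isGenPair h ht
      _ = _ := by ring

theorem integrableOn_apply_sub_inv_smul {x z z' : E} (h : IsGenPair R x z)
    (h' : IsGenPair R z z') :
    IntegrableOn (fun s : ℝ => R s z - (1 + s)⁻¹ • z) (Ioi 0) := by
  have hg : IsGenPair R (x - z) (z - z') := fun t ht => by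
    rw [map_sub, map_sub, h t ht, h' t ht]
  refine (integrable_inv_one_add_sq.integrableOn.const_mul
    (2 * ‖x - z‖ + ‖z - z'‖)).mono' ?_ ?_
  · refine ContinuousOn.aestronglyMeasurable ?_ measurableSet_Ioi
    refine (hR.continuousOn.clm_apply continuousOn_const).sub (ContinuousOn.smul ?_
      continuousOn_const)
    exact (continuousOn_const.add continuousOn_id).inv₀ fun s (hs : 0 < s) => (add_pos one_pos hs).ne'
  · filter_upwards [self_mem_ae_restrict measurableSet_Ioi] with s (hs : 0 < s)
    rw [h.apply_sub_inv_smul hs, norm_smul,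
      Real.norm_of_nonneg (by positivity : 0 ≤ (1 + s)⁻¹)]
    calc _ ≤ (1 + s)⁻¹ * ((2 * ‖x - z‖ + ‖z - z'‖) * (1 + s)⁻¹) := by
          gcongr
          exact hR.norm_yosida_le_of_isGenPair hg hs
      _ = (2 * ‖x - z‖ + ‖z - z'‖) * ((1 + s) ^ 2)⁻¹ := by field_simp
      _ ≤ _ := by
          gcongr
          nlinarith

/-- The resolvent identity gives (u - 1) Y_s Y_{su} x = u R_{su} z - R_s z, and the scalar kernel
obeys the same identity. Hence the integrand is a multiple of u D(us) - D(s) with D integrable, and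
both terms have the same integral. -/
theorem integral_ray_eq_zero {x z z' : E} (h : IsGenPair R x z) (h' : IsGenPair R z z')
    {u : ℝ} (hu : 0 < u) (hu1 : u ≠ 1) :
    ∫ s in Ioi (0 : ℝ), (yosida R s (yosida R (s * u) x) -
      ((1 + s)⁻¹ * (1 + s * u)⁻¹) • z) = 0 := by
  have hD := hR.integrableOn_apply_sub_inv_smul h h'
  set D : ℝ → E := fun s => R s z - (1 + s)⁻¹ • z with hDdef
  have hu' : u - 1 ≠ 0 := sub_ne_zero.2 hu1
  have hDu : IntegrableOn (fun s => D (u * s)) (Ioi 0) :=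
    (integrableOn_Ioi_comp_mul_left_iff D 0 hu).2 (by rwa [mul_zero])
  have hI : ∫ s in Ioi (0 : ℝ), (u - 1)⁻¹ • (u • D (u * s) - D s) = 0 := by
    have hDu' : IntegrableOn (fun s => u • D (u * s)) (Ioi 0) := hDu.smul u
    rw [integral_smul, integral_sub hDu' hD, integral_smul,
      integral_comp_mul_left_Ioi' D 0 hu, mul_zero, sub_self, smul_zero]
  rw [← hI]
  refine setIntegral_congr_fun measurableSet_Ioi (fun s (hs : 0 < s) => ?_)
  have hsu : 0 < s * u := mul_pos hs hu
  have hid := hR.sub_eq s (s * u) hs hsu z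
  refine smul_right_injective E hu' ?_
  simp only [hDdef, smul_smul, mul_inv_cancel_left₀ hu', one_smul, mul_inv_cancel₀ hu', smul_sub, h _ hsu, yosida_apply]
  have h1 : (u - 1) * s = s * u - s := by ring
  have h2 : (u - 1) * ((1 + s)⁻¹ * (1 + s * u)⁻¹) = u * (1 + s * u)⁻¹ - (1 + s)⁻¹ := by
    field_simp
    ring
  rw [h1, h2, ← hid, mul_comm u s]
  module

variable [CompleteSpace E]

theorem balakrishnan_map {x z : E} (h : IsGenPair R x z) (A : E →L[ℝ] E)
    (hA : ∀ t : ℝ, 0 < t → ∀ y, A (R t y) = R t (A y)) :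
    balakrishnan R (A x) = A (balakrishnan R x) := by
  rw [balakrishnan, balakrishnan, ← A.integral_comp_comm (hR.integrableOn_balakrishnan h)]
  refine setIntegral_congr_fun measurableSet_Ioi (fun t (ht : 0 < t) => ?_)
  simp only [yosida_apply, map_sub, map_smul, hA t ht]

theorem balakrishnan_apply {x z : E} (h : IsGenPair R x z) {s : ℝ} (hs : 0 < s) :
    balakrishnan R (R s x) = R s (balakrishnan R x) :=
  hR.balakrishnan_map h (R s) fun _ ht y => hR.comm hs ht y

theorem balakrishnan_yosida {x z : E} (h : IsGenPair R x z) {s : ℝ} (hs : 0 < s) :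
    balakrishnan R (yosida R s x) = yosida R s (balakrishnan R x) :=
  hR.balakrishnan_map h (yosida R s) fun _ ht y => (hR.yosida_comm ht hs y).symm

theorem balakrishnan_balakrishnan_of_isGenPair_isGenPair {x z z' : E} (h : IsGenPair R x z)
    (h' : IsGenPair R z z') :
    balakrishnan R (balakrishnan R x) = (Real.pi * Real.pi) • z := by
  have hF : ContinuousOn (fun p : ℝ × ℝ => yosida R p.1 (yosida R p.2 x) -
      ((1 + p.1)⁻¹ * (1 + p.2)⁻¹) • z) (Ioi 0 ×ˢ Ioi 0) := by
    have h1 : ContinuousOn (fun p : ℝ × ℝ => yosida R p.1) (Ioi 0 ×ˢ Ioi 0) :=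
      hR.continuousOn_yosida.comp continuousOn_fst fun p hp => hp.1
    have h2 : ContinuousOn (fun p : ℝ × ℝ => yosida R p.2) (Ioi 0 ×ˢ Ioi 0) :=
      hR.continuousOn_yosida.comp continuousOn_snd fun p hp => hp.2
    have h3 : ContinuousOn (fun p : ℝ × ℝ => (1 + p.1)⁻¹) (Ioi 0 ×ˢ Ioi 0) :=
      (continuousOn_const.add continuousOn_fst).inv₀ fun p hp =>
        (add_pos one_pos (mem_Ioi.1 hp.1)).ne'
    have h4 : ContinuousOn (fun p : ℝ × ℝ => (1 + p.2)⁻¹) (Ioi 0 ×ˢ Ioi 0) :=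
      (continuousOn_const.add continuousOn_snd).inv₀ fun p hp =>
        (add_pos one_pos (mem_Ioi.1 hp.2)).ne'
    exact (h1.clm_apply (h2.clm_apply continuousOn_const)).sub
      ((h3.mul h4).smul continuousOn_const)
  have hM : ∀ s t : ℝ, 0 < s → 0 < t →
      ‖yosida R s (yosida R t x) - ((1 + s)⁻¹ * (1 + t)⁻¹) • z‖ ≤
        (2 * (2 * ‖x‖ + ‖z‖) + (2 * ‖z‖ + ‖z'‖) + ‖z‖) * ((1 + s)⁻¹ * (1 + t)⁻¹) := by
    intro s t hs ht
    refine (norm_sub_le _ _).trans ?_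
    rw [norm_smul, Real.norm_of_nonneg (by positivity)]
    linarith [hR.norm_yosida_yosida_le h h' hs ht]
  have key := integral_integral_eq_zero_of_ray
    (F := fun s t => yosida R s (yosida R t x) - ((1 + s)⁻¹ * (1 + t)⁻¹) • z) hF hM
    fun u hu hu1 => hR.integral_ray_eq_zero h h' hu hu1
  have hz : Integrable (fun s : ℝ => s ^ (-(1 / 2) : ℝ) * (1 + s)⁻¹)
      (volume.restrict (Ioi 0)) := integrableOn_rpow_neg_half_mul_inv_one_add
  have hin : ∀ s : ℝ, 0 < s → ∫ t in Ioi (0 : ℝ), t ^ (-(1 / 2) : ℝ) •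
      (yosida R s (yosida R t x) - ((1 + s)⁻¹ * (1 + t)⁻¹) • z) =
      yosida R s (balakrishnan R x) - (1 + s)⁻¹ • Real.pi • z := by
    intro s hs
    have h1 : ∀ t : ℝ, t ^ (-(1 / 2) : ℝ) •
      (yosida R s (yosida R t x) - ((1 + s)⁻¹ * (1 + t)⁻¹) • z) =
        yosida R s (t ^ (-(1 / 2) : ℝ) • yosida R t x) -
          (1 + s)⁻¹ • (t ^ (-(1 / 2) : ℝ) * (1 + t)⁻¹) • z := fun t => by
      rw [map_smul]
      module
    simp only [h1]
    have hi := hR.integrableOn_balakrishnan h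
    have hz' : Integrable (fun t : ℝ => (1 + s)⁻¹ • (t ^ (-(1 / 2) : ℝ) * (1 + t)⁻¹) • z)
        (volume.restrict (Ioi 0)) := (hz.smul_const z).smul _
    rw [integral_sub ((yosida R s).integrable_comp hi) hz',
      (yosida R s).integral_comp_comm hi, integral_smul, integral_smul_const,
      integral_rpow_neg_half_mul_inv_one_add, balakrishnan]
  -- That T(Jx) = Jz makes the outer integral converge absolutely, so the difference below can be
  -- split.
  have hy : IsGenPair R (balakrishnan R x) (balakrishnan R z) := fun s hs => by
    rw [← hR.balakrishnan_yosida h hs, h s hs, hR.balakrishnan_apply h' hs]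
  have h2 : ∫ s in Ioi (0 : ℝ), (s ^ (-(1 / 2) : ℝ) • yosida R s (balakrishnan R x) -
      (s ^ (-(1 / 2) : ℝ) * (1 + s)⁻¹) • Real.pi • z) = 0 := by
    rw [← key]
    refine setIntegral_congr_fun measurableSet_Ioi (fun s (hs : 0 < s) => ?_)
    simp only [hin s hs]
    module
  rw [integral_sub (hR.integrableOn_balakrishnan hy) (hz.smul_const _), integral_smul_const,
    integral_rpow_neg_half_mul_inv_one_add, smul_smul] at h2
  exact sub_eq_zero.1 h2

/-- The square of the Balakrishnan operator is `T`, up to the factor `π²`. -/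
theorem balakrishnan_balakrishnan (hinj : Function.Injective (R 1)) {x z y' : E}
    (h : IsGenPair R x z) (hy : IsGenPair R (balakrishnan R x) y') :
    balakrishnan R (balakrishnan R x) = (Real.pi * Real.pi) • z := by
  apply hinj
  rw [← hR.balakrishnan_apply hy one_pos, ← hR.balakrishnan_apply h one_pos, map_smul]
  exact hR.balakrishnan_balakrishnan_of_isGenPair_isGenPair (hR.isGenPair_apply h one_pos)
    (hR.isGenPair_apply_yosida one_pos z)

end IsResolventFamily

end ResolventFamily

/-- Method of continuity: if `1 + κ K` is bounded below uniformly in `κ ∈ [0, 1]`, then `1 + K`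
is onto. -/
theorem surjective_one_add_of_norm_le {E : Type*} [NormedAddCommGroup E] [NormedSpace ℝ E]
    [CompleteSpace E] (K : E →L[ℝ] E) (c : ℝ)
    (h : ∀ κ : ℝ, 0 ≤ κ → κ ≤ 1 → ∀ y, ‖y‖ ≤ c * ‖y + κ • K y‖) :
    Function.Surjective fun y => y + K y := by
  have hstep : ∀ κ κ' : ℝ, 0 ≤ κ → κ ≤ 1 → |κ - κ'| * (|c| * ‖K‖) < 1 →
      IsUnit (1 + κ • K) → IsUnit (1 + κ' • K) := by
    rintro κ κ' h0 h1 hlt ⟨u, hu⟩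
    have hinv : ‖(↑u⁻¹ : E →L[ℝ] E)‖ ≤ |c| := by
      refine ContinuousLinearMap.opNorm_le_bound _ (abs_nonneg c) fun y => ?_
      have h2 := h κ h0 h1 ((↑u⁻¹ : E →L[ℝ] E) y)
      have h3 : (↑u⁻¹ : E →L[ℝ] E) y + κ • K ((↑u⁻¹ : E →L[ℝ] E) y) = y := by
        have h4 : ((u : E →L[ℝ] E) * (↑u⁻¹ : E →L[ℝ] E)) y = y := by
          rw [Units.mul_inv]; rfl
        rw [hu] at h4
        exact h4
      rw [h3] at h2
      exact h2.trans (mul_le_mul_of_nonneg_right (le_abs_self c) (norm_nonneg y))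
    -- Neumann series around κ: the admissible step depends only on |c|‖K‖, so N steps of length 1/N
    -- reach κ = 1.
    have h5 : 1 + κ' • K = (u : E →L[ℝ] E) * (1 - (κ - κ') • ((↑u⁻¹ : E →L[ℝ] E) * K)) := by
      rw [mul_sub, mul_one, mul_smul_comm, Units.mul_inv_cancel_left, hu]
      module
    rw [h5]
    refine u.isUnit.mul (isUnit_one_sub_of_norm_lt_one ?_)
    rw [norm_smul, Real.norm_eq_abs]
    refine lt_of_le_of_lt ?_ hlt
    gcongr
    exact (norm_mul_le _ _).trans (mul_le_mul_of_nonneg_right hinv (norm_nonneg K))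
  obtain ⟨N, hN⟩ := exists_nat_gt (|c| * ‖K‖)
  have hN0 : (0 : ℝ) < N := lt_of_le_of_lt (by positivity) hN
  have hind : ∀ n : ℕ, n ≤ N → IsUnit (1 + ((n : ℝ) / N) • K) := by
    intro n
    induction n with
    | zero => simp
    | succ n ih =>
      intro hn
      have hn' : (n : ℝ) ≤ N := by exact_mod_cast (Nat.le_succ n).trans hn
      refine hstep _ _ (by positivity) ((div_le_one hN0).2 hn') ?_ (ih (by omega))
      have h6 : |(n : ℝ) / N - ((n + 1 : ℕ) : ℝ) / N| = (N : ℝ)⁻¹ := by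
        rw [← sub_div]
        push_cast
        rw [sub_add_cancel_left, neg_div, abs_neg, one_div, abs_of_pos (by positivity)]
      rw [h6, inv_mul_lt_iff₀ hN0, mul_one]
      exact hN
  obtain ⟨u, hu⟩ := hind N le_rfl
  rw [div_self hN0.ne', one_smul] at hu
  intro y
  refine ⟨(↑u⁻¹ : E →L[ℝ] E) y, ?_⟩
  have h4 : ((u : E →L[ℝ] E) * (↑u⁻¹ : E →L[ℝ] E)) y = y := by
    rw [Units.mul_inv]; rfl
  rw [hu] at h4
  exact h4

/-! ### Accretive operators and the perturbation theorem -/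

section Accretive

variable {H : Type*} [NormedAddCommGroup H] [InnerProductSpace ℂ H]

theorem IsAccretive.mul_norm_le {T : H →ₗ.[ℂ] H} (hT : IsAccretive T) {t : ℝ}
    (x : T.domain) : t * ‖(x : H)‖ ≤ ‖(t : ℂ) • (x : H) + T x‖ := by
  rcases eq_or_ne (x : H) 0 with h | h
  · rw [h]
    simp
  · have h1 : t * ‖(x : H)‖ ^ 2 ≤ (inner ℂ ((t : ℂ) • (x : H) + T x) (x : H)).re := by
      rw [inner_add_left, inner_smul_left, Complex.add_re, Complex.conj_ofReal,
        Complex.re_ofReal_mul]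
      have h2 : (inner ℂ (x : H) (x : H)).re = ‖(x : H)‖ ^ 2 :=
        (norm_sq_eq_re_inner (𝕜 := ℂ) (x : H)).symm
      rw [h2]
      linarith [hT x]
    have h3 : (inner ℂ ((t : ℂ) • (x : H) + T x) (x : H)).re ≤
        ‖(t : ℂ) • (x : H) + T x‖ * ‖(x : H)‖ := re_inner_le_norm (𝕜 := ℂ) _ _
    have h4 : 0 < ‖(x : H)‖ := norm_pos_iff.2 h
    refine le_of_mul_le_mul_right ?_ h4
    calc t * ‖(x : H)‖ * ‖(x : H)‖ = t * ‖(x : H)‖ ^ 2 := by ring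
      _ ≤ _ := h1.trans h3

theorem IsAccretive.eq_of_smul_add_eq {T : H →ₗ.[ℂ] H} (hT : IsAccretive T) {t : ℝ}
    (ht : 0 < t) {x y : T.domain}
    (h : (t : ℂ) • (x : H) + T x = (t : ℂ) • (y : H) + T y) : x = y := by
  have h1 := hT.mul_norm_le (t := t) (x - y)
  have h2 : (t : ℂ) • ((x - y : T.domain) : H) + T (x - y) = 0 := by
    rw [T.map_sub, Submodule.coe_sub, smul_sub, sub_add_sub_comm, h, sub_self]
  rw [h2, norm_zero] at h1
  have h3 : ‖((x - y : T.domain) : H)‖ = 0 :=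
    le_antisymm (nonpos_of_mul_nonpos_right h1 ht) (norm_nonneg _)
  exact sub_eq_zero.1 (Subtype.ext (norm_eq_zero.1 h3))

theorem IsAccretive.exists_linear_resolvent {T : H →ₗ.[ℂ] H} (hT : IsAccretive T) {t : ℝ}
    (ht : 0 < t) (hs : ∀ y : H, ∃ x : T.domain, (t : ℂ) • (x : H) + T x = y) :
    ∃ G : H →ₗ[ℂ] T.domain, ∀ y, (t : ℂ) • (G y : H) + T (G y) = y := by
  choose g hg using hs
  refine ⟨{ toFun := g, map_add' := fun a b => ?_, map_smul' := fun c a => ?_ }, hg⟩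
  · refine hT.eq_of_smul_add_eq ht ?_
    rw [hg, T.map_add, Submodule.coe_add, smul_add, add_add_add_comm, hg, hg]
  · refine hT.eq_of_smul_add_eq ht ?_
    rw [hg, RingHom.id_apply, T.map_smul, Submodule.coe_smul, smul_comm, ← smul_add, hg]

theorem IsAccretive.exists_resolventFamily {T : H →ₗ.[ℂ] H} (hT : IsAccretive T)
    (hs : ∀ t : ℝ, 0 < t → ∀ y : H, ∃ x : T.domain, (t : ℂ) • (x : H) + T x = y) :
    ∃ R : ℝ → H →L[ℝ] H, IsResolventFamily R ∧ ∀ t : ℝ, 0 < t →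
      ∀ y, ∃ x : T.domain, (x : H) = R t y ∧ (t : ℂ) • (x : H) + T x = y := by
  have hex : ∀ t : ℝ, ∃ G : H →L[ℝ] H, 0 < t → (∀ y, t * ‖G y‖ ≤ ‖y‖) ∧
      ∀ y, ∃ x : T.domain, (x : H) = G y ∧ (t : ℂ) • (x : H) + T x = y := by
    intro t
    by_cases ht : 0 < t
    · obtain ⟨G, hG⟩ := hT.exists_linear_resolvent ht (hs t ht)
      have hb : ∀ y, t * ‖(G y : H)‖ ≤ ‖y‖ := fun y => by
        have h := hT.mul_norm_le (t := t) (G y)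
        rwa [hG y] at h
      refine ⟨((T.domain.subtype ∘ₗ G).restrictScalars ℝ).mkContinuous t⁻¹ fun y => ?_,
        fun _ => ⟨hb, fun y => ⟨G y, rfl, hG y⟩⟩⟩
      rw [inv_mul_eq_div, le_div_iff₀ ht, mul_comm]
      exact hb y
    · exact ⟨0, fun h => absurd h ht⟩
  choose R hR using hex
  refine ⟨R, ⟨fun s t hs ht y => ?_, fun t ht y => (hR t ht).1 y⟩, fun t ht => (hR t ht).2⟩
  obtain ⟨a, ha, ha'⟩ := (hR s hs).2 y
  obtain ⟨b, hb, hb'⟩ := (hR t ht).2 y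
  obtain ⟨d, hd, hd'⟩ := (hR s hs).2 (R t y)
  have key : a - b = ((t - s : ℝ) : ℂ) • d := by
    refine hT.eq_of_smul_add_eq hs ?_
    rw [T.map_sub, T.map_smul, Submodule.coe_smul, smul_comm, ← smul_add, hd', ← hb,
      Submodule.coe_sub]
    have h1 : T a = y - (s : ℂ) • (a : H) := eq_sub_of_add_eq' ha'
    have h2 : T b = y - (t : ℂ) • (b : H) := eq_sub_of_add_eq' hb'
    rw [h1, h2]
    push_cast
    module
  have key' : (a : H) - b = ((t - s : ℝ) : ℂ) • (d : H) := congrArg Subtype.val key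
  rwa [ha, hb, hd, Complex.coe_smul] at key'

/-- A densely defined accretive operator is closable. -/
theorem IsAccretive.eq_of_tendsto {C : H →ₗ.[ℂ] H} (hC : IsAccretive C)
    (hd : Dense (C.domain : Set H)) {u : ℕ → C.domain} {x : C.domain} {v : H}
    (hu : Tendsto (fun n => (u n : H)) atTop (𝓝 (x : H)))
    (hCu : Tendsto (fun n => C (u n)) atTop (𝓝 v)) : v = C x := by
  have h1 : ∀ z : C.domain, 0 ≤ (inner ℂ (v - C x + C z) (z : H)).re := by
    intro z
    have hl : Tendsto (fun n => (inner ℂ (C (u n - x + z)) ((u n - x + z : C.domain) : H)).re)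
        atTop (𝓝 (inner ℂ (v - C x + C z) ((x : H) - x + z)).re) := by
      simp only [C.map_add, C.map_sub, Submodule.coe_add, Submodule.coe_sub]
      exact (Complex.continuous_re.tendsto _).comp
        (((hCu.sub_const _).add_const _).inner ((hu.sub_const _).add_const _))
    rw [sub_self, zero_add] at hl
    exact ge_of_tendsto' hl fun n => hC _
  set p := v - C x with hp
  -- Replace z by εz, divide by ε and let ε → 0: the term with C z drops out.
  have h2 : ∀ z : C.domain, 0 ≤ (inner ℂ p (z : H)).re := by
    intro z
    have h3 : ∀ ε : ℝ, 0 < ε → 0 ≤ (inner ℂ p (z : H)).re + ε * (inner ℂ (C z) (z : H)).re := by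
      intro ε hε
      have h4 := h1 ((ε : ℂ) • z)
      rw [C.map_smul, Submodule.coe_smul, inner_smul_right, inner_add_left, inner_smul_left,
        Complex.conj_ofReal, Complex.re_ofReal_mul, Complex.add_re, Complex.re_ofReal_mul] at h4
      exact nonneg_of_mul_nonneg_right h4 hε
    have hl : Tendsto (fun ε : ℝ => (inner ℂ p (z : H)).re + ε * (inner ℂ (C z) (z : H)).re)
        (𝓝[>] 0) (𝓝 ((inner ℂ p (z : H)).re + 0 * (inner ℂ (C z) (z : H)).re)) :=
      Tendsto.mono_left (Continuous.tendsto (by fun_prop) 0) nhdsWithin_le_nhds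
    rw [zero_mul, add_zero] at hl
    refine ge_of_tendsto hl ?_
    filter_upwards [self_mem_nhdsWithin] with ε hε using h3 ε hε
  have h5 : ∀ z : H, 0 ≤ (inner ℂ p z).re := by
    have hcl : IsClosed {z : H | 0 ≤ (inner ℂ p z).re} :=
      isClosed_le continuous_const (Complex.continuous_re.comp
        (continuous_const.inner continuous_id))
    intro z
    exact hcl.closure_subset_iff.2 (fun z hz => h2 ⟨z, hz⟩) (hd z)
  have h6 := h5 (-p)
  have h7 : (inner ℂ p p).re = ‖p‖ ^ 2 := (norm_sq_eq_re_inner (𝕜 := ℂ) p).symm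
  rw [inner_neg_right, Complex.neg_re, h7] at h6
  have h8 : ‖p‖ = 0 := by nlinarith [norm_nonneg p]
  exact sub_eq_zero.1 (norm_eq_zero.1 h8)

theorem IsAccretive.add {S T : H →ₗ.[ℂ] H} (hS : IsAccretive S) (hT : IsAccretive T) :
    IsAccretive (S + T) := fun x => by
  rw [LinearPMap.add_apply, inner_add_left, Complex.add_re]
  exact add_nonneg (hS ⟨x, x.2.1⟩) (hT ⟨x, x.2.2⟩)

/-- The a priori estimate behind the perturbation theorem. -/
theorem norm_le_of_re_inner_ge {a k x : H} {α β δ μ κ : ℝ} (hα : 0 ≤ α) (hβ : 0 ≤ β)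
    (hβ1 : β < 1) (hδ : 0 ≤ δ) (hμ : 0 < μ) (hκ : 0 ≤ κ) (hκ1 : κ ≤ 1)
    (ha : 0 ≤ (inner ℂ a x).re)
    (hk : -α * ‖x‖ ^ 2 - β * ‖a‖ ^ 2 - δ * ‖a‖ * ‖x‖ ≤ (inner ℂ a k).re)
    (hx : μ * ‖x‖ ≤ ‖(μ : ℂ) • x + a + (κ : ℂ) • k‖) :
    ‖(μ : ℂ) • x + a‖ ≤
      (1 + (1 + δ / μ + α / μ ^ 2) / (1 - β)) * ‖(μ : ℂ) • x + a + (κ : ℂ) • k‖ := by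
  set v := (μ : ℂ) • x + a + (κ : ℂ) • k with hv
  have hr : 0 < 1 - β := by linarith
  -- Testing v against a yields a quadratic inequality for ‖a‖ in terms of ‖v‖, since ‖x‖ ≤ ‖v‖/μ.
  have h1 : (inner ℂ a v).re ≤ ‖a‖ * ‖v‖ := re_inner_le_norm (𝕜 := ℂ) _ _
  have h2 : (inner ℂ a v).re = μ * (inner ℂ a x).re + ‖a‖ ^ 2 + κ * (inner ℂ a k).re := by
    have h3 : (inner ℂ a a).re = ‖a‖ ^ 2 := (norm_sq_eq_re_inner (𝕜 := ℂ) a).symm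
    rw [hv, inner_add_right, inner_add_right, inner_smul_right, inner_smul_right,
      Complex.add_re, Complex.add_re, Complex.re_ofReal_mul, Complex.re_ofReal_mul, h3]
  have hn : ‖x‖ ≤ ‖v‖ / μ := by rwa [le_div_iff₀ hμ, mul_comm]
  have h4 : -(α * ‖x‖ ^ 2 + β * ‖a‖ ^ 2 + δ * ‖a‖ * ‖x‖) ≤ κ * (inner ℂ a k).re := by
    have h5 : 0 ≤ α * ‖x‖ ^ 2 + β * ‖a‖ ^ 2 + δ * ‖a‖ * ‖x‖ := by positivity
    nlinarith
  have h6 : (1 - β) * ‖a‖ ^ 2 ≤ ‖a‖ * ‖v‖ + α * (‖v‖ / μ) ^ 2 + δ * ‖a‖ * (‖v‖ / μ) := by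
    have h7 : α * ‖x‖ ^ 2 ≤ α * (‖v‖ / μ) ^ 2 := by gcongr
    have h8 : δ * ‖a‖ * ‖x‖ ≤ δ * ‖a‖ * (‖v‖ / μ) := by gcongr
    have h9 : 0 ≤ μ * (inner ℂ a x).re := by positivity
    linarith
  have hp : 0 ≤ δ / μ := by positivity
  have hq : 0 ≤ α / μ ^ 2 := by positivity
  have h10 : (1 - β) * ‖a‖ ^ 2 ≤ (1 + δ / μ) * (‖a‖ * ‖v‖) + α / μ ^ 2 * ‖v‖ ^ 2 := by
    calc _ ≤ _ := h6
      _ = _ := by ring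
  have h11 : ‖a‖ ≤ (1 + δ / μ + α / μ ^ 2) / (1 - β) * ‖v‖ := by
    rw [div_mul_eq_mul_div, le_div_iff₀ hr]
    rcases le_total ‖a‖ ‖v‖ with h | h
    · calc ‖a‖ * (1 - β) ≤ ‖v‖ * 1 := by gcongr; linarith
        _ = 1 * ‖v‖ := by ring
        _ ≤ _ := by gcongr; linarith
    · rcases (norm_nonneg a).eq_or_lt with h0 | h0
      · rw [← h0, zero_mul]; positivity
      · refine le_of_mul_le_mul_right ?_ h0
        have h12 : α / μ ^ 2 * ‖v‖ ^ 2 ≤ α / μ ^ 2 * (‖a‖ * ‖v‖) := by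
          rw [sq ‖v‖]; gcongr
        linarith
  calc ‖(μ : ℂ) • x + a‖ ≤ ‖(μ : ℂ) • x‖ + ‖a‖ := norm_add_le _ _
    _ = μ * ‖x‖ + ‖a‖ := by rw [norm_smul, Complex.norm_real, Real.norm_of_nonneg hμ.le]
    _ ≤ ‖v‖ + (1 + δ / μ + α / μ ^ 2) / (1 - β) * ‖v‖ := add_le_add hx h11
    _ = _ := by ring

/-- Okazawa's perturbation theorem: `μ + A + C` is onto for `μ > 0` if `A` is m-accretive, `C` is
accretive, `D(A) ⊆ D(C)` and `Re ⟨A x, C x⟩` is bounded below as in `hAC`. -/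
theorem IsMAccretive.exists_smul_add_eq [CompleteSpace H] {A C : H →ₗ.[ℂ] H}
    (hA : IsMAccretive A) (hC : IsAccretive C) (hdom : A.domain ≤ C.domain) {α β δ : ℝ}
    (hα : 0 ≤ α) (hβ : 0 ≤ β) (hβ1 : β < 1) (hδ : 0 ≤ δ)
    (hAC : ∀ (x : H) (hx : x ∈ A.domain) (hx' : x ∈ C.domain),
      -α * ‖x‖ ^ 2 - β * ‖A ⟨x, hx⟩‖ ^ 2 - δ * ‖A ⟨x, hx⟩‖ * ‖x‖ ≤
        (inner ℂ (A ⟨x, hx⟩) (C ⟨x, hx'⟩)).re)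
    {μ : ℝ} (hμ : 0 < μ) (y : H) : ∃ x : (A + C).domain, (μ : ℂ) • (x : H) + (A + C) x = y := by
  obtain ⟨G, hG⟩ := hA.1.exists_linear_resolvent hμ (hA.2.2 μ hμ)
  have hGb : ∀ y, μ * ‖(G y : H)‖ ≤ ‖y‖ := fun y => by
    have h := hA.1.mul_norm_le (t := μ) (G y)
    rwa [hG y] at h
  have hGc : Continuous fun y => (G y : H) := by
    refine ((A.domain.subtype ∘ₗ G).mkContinuous μ⁻¹ fun y => ?_).continuous
    rw [inv_mul_eq_div, le_div_iff₀ hμ, mul_comm]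
    exact hGb y
  -- K = C(μ + A)⁻¹, so that μ + A + κC = (1 + κK)(μ + A). Closability of C makes K bounded by the
  -- closed graph theorem.
  let K : H →ₗ[ℂ] H := C.toFun ∘ₗ Submodule.inclusion hdom ∘ₗ G
  have hKapp : ∀ y, K y = C ⟨G y, hdom (G y).2⟩ := fun y => rfl
  have hKc : Continuous K := by
    refine K.continuous_of_seq_closed_graph fun u x v hu hv => ?_
    exact hC.eq_of_tendsto (hA.2.1.mono hdom) (u := fun n => Submodule.inclusion hdom (G (u n)))
      (x := Submodule.inclusion hdom (G x)) ((hGc.tendsto x).comp hu) hv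
  let K' : H →L[ℝ] H := ⟨K.restrictScalars ℝ, hKc⟩
  obtain ⟨w, hw⟩ := surjective_one_add_of_norm_le K' _ (fun κ hκ hκ1 w => by
    have hκC : IsAccretive (A + (κ : ℂ) • C) := hA.1.add fun z => by
      rw [LinearPMap.smul_apply, inner_smul_left, Complex.conj_ofReal, Complex.re_ofReal_mul]
      exact mul_nonneg hκ (hC z)
    have h1 := hκC.mul_norm_le (t := μ) ⟨G w, (G w).2, hdom (G w).2⟩
    rw [LinearPMap.add_apply, LinearPMap.smul_apply, ← add_assoc] at h1
    have h2 := norm_le_of_re_inner_ge hα hβ hβ1 hδ hμ hκ hκ1 (hA.1 (G w))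
      (hAC _ (G w).2 (hdom (G w).2)) h1
    rw [hG w, Complex.coe_smul] at h2
    exact h2) y
  refine ⟨⟨G w, (G w).2, hdom (G w).2⟩, ?_⟩
  rw [LinearPMap.add_apply, ← add_assoc]
  calc _ = w + K w := congrArg (· + K w) (hG w)
    _ = y := hw

end Accretive

/-! ### The square root on the domain of the operator -/

section Sqrt

variable {H : Type*} [NormedAddCommGroup H] [InnerProductSpace ℂ H]
  {T : H →ₗ.[ℂ] H} (hT : IsAccretive T) {R : ℝ → H →L[ℝ] H} (hR : IsResolventFamily R)
  (hRT : ∀ t : ℝ, 0 < t → ∀ y, ∃ x : T.domain, (x : H) = R t y ∧ (t : ℂ) • (x : H) + T x = y)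
include hT hRT

theorem resolvent_smul_add {t : ℝ} (ht : 0 < t) (x : T.domain) :
    R t ((t : ℂ) • (x : H) + T x) = x := by
  obtain ⟨a, ha, ha'⟩ := hRT t ht ((t : ℂ) • (x : H) + T x)
  rw [← ha, hT.eq_of_smul_add_eq ht ha']

theorem isGenPair_of_resolvent (x : T.domain) : IsGenPair R (x : H) (T x) := fun t ht => by
  have h := resolvent_smul_add hT hRT ht x
  rw [map_add, Complex.coe_smul, map_smul] at h
  rw [yosida_apply]
  exact sub_eq_of_eq_add' h.symm

theorem apply_eq_yosida {t : ℝ} (ht : 0 < t) {x : H} {a : T.domain}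
    (ha : (t : ℂ) • (a : H) + T a = x) : T a = yosida R t x := by
  have h := resolvent_smul_add hT hRT ht a
  rw [ha] at h
  rw [yosida_apply, h, ← Complex.coe_smul]
  exact eq_sub_of_add_eq' ha

omit hT in
theorem resolvent_injective {t : ℝ} (ht : 0 < t) : Function.Injective (R t) := fun y z h => by
  obtain ⟨a, ha, ha'⟩ := hRT t ht y
  obtain ⟨b, hb, hb'⟩ := hRT t ht z
  rw [← ha', ← hb', Subtype.ext (ha.trans (h.trans hb.symm))]

include hR

/-- Accretivity makes t + T injective, so T (r t) = Y_t x for every admissible r and t > 0; values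
at t ≤ 0 do not matter. -/
theorem mem_balakrishnanGraph_iff {p : H × H} : p ∈ balakrishnanGraph T ↔
    p.1 ∈ T.domain ∧ p.2 = ((1 / Real.pi : ℝ) : ℂ) • balakrishnan R p.1 := by
  have hcongr : ∀ (x : H) (r : ℝ → T.domain),
      (∀ t : ℝ, 0 < t → (t : ℂ) • (r t : H) + T (r t) = x) → EqOn
        (fun t : ℝ => t ^ (-(1 / 2) : ℝ) • yosida R t x)
        (fun t : ℝ => ((t ^ (-(1 / 2) : ℝ) : ℝ) : ℂ) • T (r t)) (Ioi 0) :=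
    fun x r hr t (ht : 0 < t) => by
      simp only [Complex.coe_smul, apply_eq_yosida hT hRT ht (hr t ht)]
  constructor
  · rintro ⟨hx, r, hr, -, hy⟩
    exact ⟨hx, by
      rw [hy, balakrishnan, setIntegral_congr_fun measurableSet_Ioi (hcongr _ r hr)]⟩
  · rintro ⟨hx, hy⟩
    have hex : ∀ t : ℝ, ∃ a : T.domain, 0 < t → (t : ℂ) • (a : H) + T a = p.1 := fun t => by
      by_cases ht : 0 < t
      · obtain ⟨a, -, ha⟩ := hRT t ht p.1
        exact ⟨a, fun _ => ha⟩
      · exact ⟨0, fun h => absurd h ht⟩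
    choose r hr using hex
    refine ⟨hx, r, hr, ?_, ?_⟩
    · exact (hR.integrableOn_balakrishnan
        (isGenPair_of_resolvent hT hRT ⟨p.1, hx⟩)).congr_fun (hcongr _ r hr) measurableSet_Ioi
    · rw [hy, balakrishnan, setIntegral_congr_fun measurableSet_Ioi (hcongr _ r hr)]

theorem sqrt_eq_balakrishnan {x : H} (hx : x ∈ T.domain) :
    ∃ h : x ∈ (sqrt T).domain, sqrt T ⟨x, h⟩ = Real.pi⁻¹ • balakrishnan R x := by
  have hiff := fun p => mem_balakrishnanGraph_iff hT hR hRT (p := p)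
  have hg : ∀ p ∈ balakrishnanGraph T, p.1 = 0 → p.2 = 0 := fun p hp h0 => by
    rw [((hiff p).1 hp).2, h0]
    simp [balakrishnan]
  have hmem : (x, ((1 / Real.pi : ℝ) : ℂ) • balakrishnan R x) ∈ balakrishnanGraph T :=
    (hiff _).2 ⟨hx, rfl⟩
  have hdom : x ∈ (balakrishnanGraph T).toLinearPMap.domain := ⟨_, hmem, rfl⟩
  have hval := ((hiff _).1 ((balakrishnanGraph T).mem_graph_toLinearPMap hg ⟨x, hdom⟩)).2
  -- The closure extends the operator, so the values on D(T) are those of the graph; closability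
  -- plays no role here.
  have hle := (balakrishnanGraph T).toLinearPMap.le_closure
  refine ⟨hle.1 hdom, ?_⟩
  rw [← one_div, ← Complex.coe_smul]
  exact (hle.2 (x := ⟨x, hdom⟩) rfl).symm.trans hval

end Sqrt

/-! ### S² = T, and the products multiplied out -/

section Factorization

variable {H : Type*} [NormedAddCommGroup H] [InnerProductSpace ℂ H]

theorem domain_le_sqrt_domain {T : H →ₗ.[ℂ] H} (hT : IsAccretive T)
    (hs : ∀ t : ℝ, 0 < t → ∀ y : H, ∃ x : T.domain, (t : ℂ) • (x : H) + T x = y) :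
    T.domain ≤ (sqrt T).domain := fun _ hx => by
  obtain ⟨R, hR, hRT⟩ := hT.exists_resolventFamily hs
  exact (sqrt_eq_balakrishnan hT hR hRT hx).1

theorem sqrt_sqrt [CompleteSpace H] {T : H →ₗ.[ℂ] H} (hT : IsAccretive T)
    (hs : ∀ t : ℝ, 0 < t → ∀ y : H, ∃ x : T.domain, (t : ℂ) • (x : H) + T x = y)
    {x : H} (hx : x ∈ T.domain) (h : x ∈ (sqrt T).domain)
    (hS : sqrt T ⟨x, h⟩ ∈ T.domain) (hS' : sqrt T ⟨x, h⟩ ∈ (sqrt T).domain) :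
    sqrt T ⟨sqrt T ⟨x, h⟩, hS'⟩ = T ⟨x, hx⟩ := by
  obtain ⟨R, hR, hRT⟩ := hT.exists_resolventFamily hs
  obtain ⟨h1, h2⟩ := sqrt_eq_balakrishnan hT hR hRT hx
  obtain ⟨h3, h4⟩ := sqrt_eq_balakrishnan hT hR hRT hS
  have hb : balakrishnan R x ∈ T.domain := by
    have h5 := T.domain.smul_mem (Real.pi : ℂ) hS
    rwa [h2, Complex.coe_smul, smul_inv_smul₀ Real.pi_ne_zero] at h5
  have hpair := isGenPair_of_resolvent hT hRT ⟨_, hb⟩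
  have hsq := hR.balakrishnan_balakrishnan (resolvent_injective hRT one_pos)
    (isGenPair_of_resolvent hT hRT ⟨x, hx⟩) hpair
  -- A multiple of the identity commutes with the resolvents, which pulls the inner factor π⁻¹ out
  -- of J.
  have hsmul := hR.balakrishnan_map hpair (Real.pi⁻¹ • ContinuousLinearMap.id ℝ H)
    fun t _ y => by simp
  refine h4.trans ?_
  rw [h2]
  refine (congrArg (Real.pi⁻¹ • ·) hsmul).trans ?_
  simp only [smul_apply, ContinuousLinearMap.id_apply, hsq, smul_smul]
  rw [← mul_assoc Real.pi⁻¹ Real.pi, inv_mul_cancel₀ Real.pi_ne_zero, one_mul,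
    inv_mul_cancel₀ Real.pi_ne_zero, one_smul]

/-- The two factorizations of the pencil, multiplied out. -/
theorem factors_apply {B S : H →ₗ.[ℂ] H} {x : H} (c : ℂ) (hB : x ∈ B.domain)
    (hS : x ∈ S.domain) (hBB : B ⟨x, hB⟩ ∈ B.domain) (hBS : S ⟨x, hS⟩ ∈ B.domain)
    (hSB : B ⟨x, hB⟩ ∈ S.domain) (hSS : S ⟨x, hS⟩ ∈ S.domain) :
    (∃ h : x ∈ (factors (B + S) (B - S) c).domain, factors (B + S) (B - S) c ⟨x, h⟩ =
      c ^ 2 • x - (2 * c) • B ⟨x, hB⟩ + B ⟨_, hBB⟩ - S ⟨_, hSS⟩ -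
        (B ⟨_, hBS⟩ - S ⟨_, hSB⟩)) ∧
    ∃ h : x ∈ (factors (B - S) (B + S) c).domain, factors (B - S) (B + S) c ⟨x, h⟩ =
      c ^ 2 • x - (2 * c) • B ⟨x, hB⟩ + B ⟨_, hBB⟩ - S ⟨_, hSS⟩ +
        (B ⟨_, hBS⟩ - S ⟨_, hSB⟩) := by
  have hpos : x ∈ (scalar c - (B + S)).domain := ⟨Submodule.mem_top, hB, hS⟩
  have hneg : x ∈ (scalar c - (B - S)).domain := ⟨Submodule.mem_top, hB, hS⟩
  have vpos : (scalar c - (B + S) : H →ₗ.[ℂ] H) ⟨x, hpos⟩ = c • x - (B ⟨x, hB⟩ + S ⟨x, hS⟩) := rfl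
  have vneg : (scalar c - (B - S) : H →ₗ.[ℂ] H) ⟨x, hneg⟩ = c • x - (B ⟨x, hB⟩ - S ⟨x, hS⟩) := rfl
  -- The sign ε = ±1 treats both inner factors at once.
  have mB : ∀ ε : ℂ, c • x - (B ⟨x, hB⟩ + ε • S ⟨x, hS⟩) ∈ B.domain := fun ε =>
    B.domain.sub_mem (B.domain.smul_mem c hB) (B.domain.add_mem hBB (B.domain.smul_mem ε hBS))
  have mS : ∀ ε : ℂ, c • x - (B ⟨x, hB⟩ + ε • S ⟨x, hS⟩) ∈ S.domain := fun ε =>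
    S.domain.sub_mem (S.domain.smul_mem c hS) (S.domain.add_mem hSB (S.domain.smul_mem ε hSS))
  have lin : ∀ (F : H →ₗ.[ℂ] H) (ε : ℂ) {u v w : H} (hu : u ∈ F.domain) (hv : v ∈ F.domain)
      (hw : w ∈ F.domain) (h : c • u - (v + ε • w) ∈ F.domain), F ⟨c • u - (v + ε • w), h⟩ =
        c • F ⟨u, hu⟩ - (F ⟨v, hv⟩ + ε • F ⟨w, hw⟩) := fun F ε u v w hu hv hw h => by
    rw [← F.map_smul, ← F.map_smul, ← F.map_add, ← F.map_sub]
    rfl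
  have hsub : (scalar c - (B - S) : H →ₗ.[ℂ] H) ⟨x, hneg⟩ = c • x - (B ⟨x, hB⟩ + (-1 : ℂ) • S ⟨x, hS⟩) := by
    rw [vneg]; module
  have hadd : (scalar c - (B + S) : H →ₗ.[ℂ] H) ⟨x, hpos⟩ = c • x - (B ⟨x, hB⟩ + (1 : ℂ) • S ⟨x, hS⟩) := by
    rw [vpos]; module
  have key : ∀ {Z : H →ₗ.[ℂ] H} {W : H →ₗ.[ℂ] H} {w : H} (hw : x ∈ (scalar c - W).domain)
      (_ : (scalar c - W : H →ₗ.[ℂ] H) ⟨x, hw⟩ = w) (hZ : w ∈ Z.domain),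
      ∃ h : x ∈ (factors Z W c).domain, factors Z W c ⟨x, h⟩ = c • w - Z ⟨w, hZ⟩ := by
    rintro Z W w hw rfl hZ
    exact ⟨mem_prod_domain.2 ⟨hw, Submodule.mem_top, hZ⟩, rfl⟩
  constructor
  · obtain ⟨h, h'⟩ := key (Z := B + S) hneg hsub ⟨mB (-1), mS (-1)⟩
    refine ⟨h, h'.trans ?_⟩
    rw [LinearPMap.add_apply, lin B _ hB hBB hBS, lin S _ hS hSB hSS]
    module
  · obtain ⟨h, h'⟩ := key (Z := B - S) hpos hadd ⟨mB 1, mS 1⟩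
    refine ⟨h, h'.trans ?_⟩
    rw [LinearPMap.sub_apply, lin B _ hB hBB hBS, lin S _ hS hSB hSS]
    module

end Factorization

end QuadPencil

/-! ### The factorization of the pencil -/

theorem proposition3p4 {H : Type*} [NormedAddCommGroup H] [InnerProductSpace ℂ H]
    [CompleteSpace H] (B C : H →ₗ.[ℂ] H)
    (hB : QuadPencil.IsMAccretive (QuadPencil.square B))
    (hC : QuadPencil.IsAccretive C)
    (hdom : (QuadPencil.square B).domain ≤ C.domain)
    (hC1 : ∃ α β δ : ℝ, 0 ≤ α ∧ 0 ≤ β ∧ β < 1 ∧ 0 ≤ δ ∧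
      ∀ (x : H) (hx : x ∈ (QuadPencil.square B).domain) (hx' : x ∈ C.domain),
        -α * ‖x‖ ^ 2 - β * ‖QuadPencil.square B ⟨x, hx⟩‖ ^ 2
            - δ * ‖QuadPencil.square B ⟨x, hx⟩‖ * ‖x‖
          ≤ (inner ℂ (QuadPencil.square B ⟨x, hx⟩) (C ⟨x, hx'⟩)).re)
    (hBinv : ∀ x : B.domain, (x : H) ∈ (QuadPencil.square B).domain →
      B x ∈ (QuadPencil.square B).domain)
    (hSinv : ∀ x : (QuadPencil.sqrt (QuadPencil.Lam B C)).domain,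
      (x : H) ∈ (QuadPencil.square B).domain →
        QuadPencil.sqrt (QuadPencil.Lam B C) x ∈ (QuadPencil.square B).domain) :
    (∀ (c : ℂ) (x : H), x ∈ (QuadPencil.square B).domain →
      ∃ (hQ : x ∈ (QuadPencil.pencil B C c).domain)
        (h₁₂ : x ∈ (QuadPencil.factors (QuadPencil.Z₁ B C) (QuadPencil.Z₂ B C) c).domain)
        (h₂₁ : x ∈ (QuadPencil.factors (QuadPencil.Z₂ B C) (QuadPencil.Z₁ B C) c).domain),
        QuadPencil.pencil B C c ⟨x, hQ⟩ =
          (1 / 2 : ℂ) • QuadPencil.factors (QuadPencil.Z₁ B C) (QuadPencil.Z₂ B C) c ⟨x, h₁₂⟩ +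
          (1 / 2 : ℂ) • QuadPencil.factors (QuadPencil.Z₂ B C) (QuadPencil.Z₁ B C) c ⟨x, h₂₁⟩) ∧
    ((∀ (x : H), x ∈ (QuadPencil.square B).domain →
        ∀ (h : x ∈ (QuadPencil.prod B (QuadPencil.sqrt (QuadPencil.Lam B C))).domain)
          (h' : x ∈ (QuadPencil.prod (QuadPencil.sqrt (QuadPencil.Lam B C)) B).domain),
          QuadPencil.prod B (QuadPencil.sqrt (QuadPencil.Lam B C)) ⟨x, h⟩ =
            QuadPencil.prod (QuadPencil.sqrt (QuadPencil.Lam B C)) B ⟨x, h'⟩) →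
      ∀ (c : ℂ) (x : H), x ∈ (QuadPencil.square B).domain →
        ∃ (hQ : x ∈ (QuadPencil.pencil B C c).domain)
          (h₁₂ : x ∈ (QuadPencil.factors (QuadPencil.Z₁ B C) (QuadPencil.Z₂ B C) c).domain)
          (h₂₁ : x ∈ (QuadPencil.factors (QuadPencil.Z₂ B C) (QuadPencil.Z₁ B C) c).domain),
          QuadPencil.pencil B C c ⟨x, hQ⟩ =
            QuadPencil.factors (QuadPencil.Z₁ B C) (QuadPencil.Z₂ B C) c ⟨x, h₁₂⟩ ∧
          QuadPencil.factors (QuadPencil.Z₁ B C) (QuadPencil.Z₂ B C) c ⟨x, h₁₂⟩ =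
            QuadPencil.factors (QuadPencil.Z₂ B C) (QuadPencil.Z₁ B C) c ⟨x, h₂₁⟩) := by
  obtain ⟨α, β, δ, hα, hβ, hβ1, hδ, hre⟩ := hC1
  have hacc : QuadPencil.IsAccretive (QuadPencil.Lam B C) := hB.1.add hC
  have hsurj : ∀ t : ℝ, 0 < t → ∀ y : H, ∃ x : (QuadPencil.Lam B C).domain,
      (t : ℂ) • (x : H) + QuadPencil.Lam B C x = y := fun t ht y =>
    hB.exists_smul_add_eq hC hdom hα hβ hβ1 hδ hre ht y
  have hLam : ∀ {x : H}, x ∈ (QuadPencil.square B).domain → x ∈ (QuadPencil.Lam B C).domain :=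
    fun hx => ⟨hx, hdom hx⟩
  have hsqrt : ∀ {x : H}, x ∈ (QuadPencil.square B).domain →
      x ∈ (QuadPencil.sqrt (QuadPencil.Lam B C)).domain :=
    fun hx => QuadPencil.domain_le_sqrt_domain hacc hsurj (hLam hx)
  have hsqB : ∀ {x : H}, x ∈ (QuadPencil.square B).domain → x ∈ B.domain :=
    fun hx => (QuadPencil.mem_prod_domain.1 hx).1
  -- Each product equals the pencil up to the commutator BS - SB, with opposite signs; both claims
  -- follow from this.
  have main : ∀ (c : ℂ) (x : H) (hx : x ∈ (QuadPencil.square B).domain),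
      ∃ (hQ : x ∈ (QuadPencil.pencil B C c).domain)
        (h₁₂ : x ∈ (QuadPencil.factors (QuadPencil.Z₁ B C) (QuadPencil.Z₂ B C) c).domain)
        (h₂₁ : x ∈ (QuadPencil.factors (QuadPencil.Z₂ B C) (QuadPencil.Z₁ B C) c).domain)
        (hBS : x ∈ (QuadPencil.prod B (QuadPencil.sqrt (QuadPencil.Lam B C))).domain)
        (hSB : x ∈ (QuadPencil.prod (QuadPencil.sqrt (QuadPencil.Lam B C)) B).domain),
        QuadPencil.factors (QuadPencil.Z₁ B C) (QuadPencil.Z₂ B C) c ⟨x, h₁₂⟩ =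
          QuadPencil.pencil B C c ⟨x, hQ⟩ -
            (QuadPencil.prod B (QuadPencil.sqrt (QuadPencil.Lam B C)) ⟨x, hBS⟩ -
              QuadPencil.prod (QuadPencil.sqrt (QuadPencil.Lam B C)) B ⟨x, hSB⟩) ∧
        QuadPencil.factors (QuadPencil.Z₂ B C) (QuadPencil.Z₁ B C) c ⟨x, h₂₁⟩ =
          QuadPencil.pencil B C c ⟨x, hQ⟩ +
            (QuadPencil.prod B (QuadPencil.sqrt (QuadPencil.Lam B C)) ⟨x, hBS⟩ -
              QuadPencil.prod (QuadPencil.sqrt (QuadPencil.Lam B C)) B ⟨x, hSB⟩) := by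
    intro c x hx
    have hBx := hBinv ⟨x, hsqB hx⟩ hx
    have hSx := hSinv ⟨x, hsqrt hx⟩ hx
    obtain ⟨⟨h₁₂, e₁₂⟩, h₂₁, e₂₁⟩ := QuadPencil.factors_apply c (hsqB hx) (hsqrt hx) (hsqB hBx)
      (hsqB hSx) (hsqrt hBx) (hsqrt hSx)
    have hQ : x ∈ (QuadPencil.pencil B C c).domain :=
      ⟨⟨Submodule.mem_top, hsqB hx⟩, hdom hx⟩
    have vQ : QuadPencil.pencil B C c ⟨x, hQ⟩ =
        c ^ 2 • x - (2 * c) • B ⟨x, hsqB hx⟩ - C ⟨x, hdom hx⟩ := rfl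
    have vS : QuadPencil.sqrt (QuadPencil.Lam B C) ⟨_, hsqrt hSx⟩ =
        B ⟨_, hsqB hBx⟩ + C ⟨x, hdom hx⟩ :=
      QuadPencil.sqrt_sqrt hacc hsurj (hLam hx) (hsqrt hx) (hLam hSx) (hsqrt hSx)
    have hv : c ^ 2 • x - (2 * c) • B ⟨x, hsqB hx⟩ + B ⟨_, hsqB hBx⟩ -
        QuadPencil.sqrt (QuadPencil.Lam B C) ⟨_, hsqrt hSx⟩ =
          QuadPencil.pencil B C c ⟨x, hQ⟩ := by
      rw [vQ, vS]
      module
    rw [hv] at e₁₂ e₂₁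
    exact ⟨hQ, h₁₂, h₂₁, QuadPencil.mem_prod_domain.2 ⟨hsqrt hx, hsqB hSx⟩,
      QuadPencil.mem_prod_domain.2 ⟨hsqB hx, hsqrt hBx⟩, e₁₂, e₂₁⟩
  refine ⟨fun c x hx => ?_, fun hcomm c x hx => ?_⟩
  · obtain ⟨hQ, h₁₂, h₂₁, _, _, e₁₂, e₂₁⟩ := main c x hx
    refine ⟨hQ, h₁₂, h₂₁, ?_⟩
    rw [e₁₂, e₂₁]
    module
  · obtain ⟨hQ, h₁₂, h₂₁, hBS, hSB, e₁₂, e₂₁⟩ := main c x hx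
    rw [hcomm x hx hBS hSB, sub_self, sub_zero] at e₁₂
    rw [hcomm x hx hBS hSB, sub_self, add_zero] at e₂₁
    exact ⟨hQ, h₁₂, h₂₁, e₁₂.symm, e₁₂.trans e₂₁.symm⟩
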